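/- Let FI be the category whose objects are finite sets and whose morphisms are injections. Let $k$ be a field of characteristic $0$, and let $V$ be an FI-module over $k$, that is, a functor from FI to the category of $k$-vector spaces. Write $V_n := V(\{1,\dots,n\})$; functoriality makes $V_n$ a representation of the symmetric group $S_n$. Assume that $V$ is finitely generated: there is a finite set $S\subset\coprod_{n\ge 0} V_n$ such that no proper sub-FI-module of $V$ contains $S$. For $i\ge 1$ and $\sigma\in S_n$, let $X_i(\sigma)$ be the number of $i$-cycles in the cycle decomposition of $\sigma$ (so $X_1(\sigma)$ is the number of fixed points). Then every $V_n$ is finite-dimensional, and the sequence of characters $\chi_{V_n}(\sigma)=\operatorname{Trace}(\sigma\mid V_n)$ is eventually polynomial: there exist $N\ge 0$, $r>0$ and a polynomial $P\in\mathbb{Q}[X_1,\dots,X_r]$ such that $$\chi_{V_n}(\sigma)=P\bigl(X_1(\sigma),\dots,X_r(\sigma)\bigr)\qquad\text{for all } n\ge N \text{ and all } \sigma\in S_n .$$ In particular, $\dim_k V_n$ is a polynomial in $n$ for $n\ge N$: there is $Q\in\mathbb{Q}[T]$ with $\dim_k V_n=Q(n)$ for all $n\ge N$. -/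

import Mathlib

open CategoryTheory

universe v u

/-- Objects of the category `FI`: finite sets. -/
structure FI where
  /-- the underlying set -/
  carrier : Type
  [finite : Finite carrier]

namespace FI

/-- The category `FI`: morphisms are the injections, with the usual composition of maps
(`f ≫ g` is `f` followed by `g`). -/
instance : Category FI where
  Hom X Y := X.carrier ↪ Y.carrier
  id X := Function.Embedding.refl X.carrier
  comp f g := Function.Embedding.trans f g

/-- The standard set with `n` elements. -/
def std (n : ℕ) : FI := ⟨Fin n⟩

/-- A permutation of the standard set with `n` elements, as an endomorphism in `FI`. -/
def ofPerm {n : ℕ} (σ : Equiv.Perm (Fin n)) : std n ⟶ std n := σ.toEmbedding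

end FI

/-- An FI-module over `k`: a functor from `FI` to the category of `k`-modules. -/
abbrev FIModule (k : Type u) [Ring k] := FI ⥤ ModuleCat.{v} k

namespace FIModule

variable {k : Type u}

/-- A sub-FI-module: a submodule of every `V(X)`, compatible with all induced maps. -/
structure Sub [Ring k] (V : FIModule.{v} k) where
  /-- the submodule of `V(X)` -/
  submodule : (X : FI) → Submodule k (V.obj X)
  map_mem : ∀ {X Y : FI} (f : X ⟶ Y) (x : V.obj X),
    x ∈ submodule X → (V.map f).hom x ∈ submodule Y

/-- `V` is finitely generated: there is a finite set `S` of elements of `∐ₙ Vₙ` such that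
every sub-FI-module of `V` containing `S` is all of `V`. -/
def FinitelyGenerated [Ring k] (V : FIModule.{v} k) : Prop :=
  ∃ S : Set (Σ n : ℕ, V.obj (FI.std n)), S.Finite ∧
    ∀ W : Sub V, (∀ s ∈ S, s.2 ∈ W.submodule (FI.std s.1)) → ∀ X : FI, W.submodule X = ⊤

/-- The representation of the symmetric group `Sₙ` on `Vₙ`. -/
def rep [CommRing k] (V : FIModule.{v} k) (n : ℕ) :
    Representation k (Equiv.Perm (Fin n)) (V.obj (FI.std n)) where
  toFun σ := (V.map (FI.ofPerm σ)).hom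
  map_one' := by
    change (V.map (𝟙 (FI.std n))).hom = _
    rw [V.map_id]
    rfl
  map_mul' σ τ := by
    change (V.map (FI.ofPerm τ ≫ FI.ofPerm σ)).hom = _
    rw [V.map_comp]
    rfl

end FIModule

/-- `cycleCount i σ` is `Xᵢ(σ)`, the number of `i`-cycles in the cycle decomposition of `σ`,
where fixed points count as `1`-cycles. -/
def cycleCount {n : ℕ} (i : ℕ) (σ : Equiv.Perm (Fin n)) : ℕ :=
  σ.partition.parts.count i

/-- The value at `σ` of the character polynomial `P(X₁, …, X_r)`; the variable of `P` with
index `j = 0, …, r - 1` stands for `X_{j+1}`. -/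
noncomputable def charPolyEval {n r : ℕ} (P : MvPolynomial (Fin r) ℚ)
    (σ : Equiv.Perm (Fin n)) : ℚ :=
  MvPolynomial.eval (fun j : Fin r => (cycleCount (j.val + 1) σ : ℚ)) P

/-! For a permutation τ of a finite set A, count the maps f : A → Fin n with σ ∘ f = f ∘ τ
(`intertwinerCount`). When τ is a disjoint union of rotations of positive lengths j, this is the
product of the numbers of fixed points of the σ ^ j, and each factor is the sum of i * Xᵢ(σ) over i
∣ j: a polynomial in the Xᵢ independent of n. So it suffices to write the character of Vₙ, for all
large n, as one fixed rational combination of finitely many such counts.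

Span (`exists_finite_character_mem_span`): Vₙ is spanned by a family of vectors indexed by
injections Fin m ↪ Fin n and permuted by Sₙ. Its character is therefore a sum of terms h(f, σ ∘ f)
with h invariant, so h depends only on which values of f and σ ∘ f coincide. Counting the f with
prescribed coincidences reduces, by inclusion-exclusion and elimination of unknowns, to products of
fixed-point counts. Hence every character lies in the span of a finite family of counts that does
not depend on n; the coefficients may still depend on n.

Inner products (`eventually_average_eq`): the average over Sₙ of the character times a count is a
trace on the Sₙ-invariants of k[Fin n ^ A] ⊗ Vₙ. For large n these invariants surject onto the next
ones, so their dimensions, and then the traces, stabilise. The constant FI-module gives the same for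
the Gram matrix of the counts.

Conclusion (`exists_eventually_eq_sum`): characters of Sₙ are rational, so one may work over ℚ,
where the averaging form is positive definite. Coefficients found in one large degree have the
correct inner products in all later degrees, so they remain correct there. -/

/-! ### Averaged traces and stabilisation of invariants -/

section Averaging

open Filter LinearMap

theorem sum_linearMap_comp {R M N P ι : Type*} [CommSemiring R] [AddCommMonoid M] [Module R M]
    [AddCommMonoid N] [Module R N] [AddCommMonoid P] [Module R P] (s : Finset ι)
    (f : ι → N →ₗ[R] P) (g : M →ₗ[R] N) : (∑ i ∈ s, f i) ∘ₗ g = ∑ i ∈ s, f i ∘ₗ g := by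
  ext x
  simp [LinearMap.sum_apply]

theorem linearMap_comp_sum {R M N P ι : Type*} [CommSemiring R] [AddCommMonoid M] [Module R M]
    [AddCommMonoid N] [Module R N] [AddCommMonoid P] [Module R P] (s : Finset ι)
    (f : N →ₗ[R] P) (g : ι → M →ₗ[R] N) : f ∘ₗ (∑ i ∈ s, g i) = ∑ i ∈ s, f ∘ₗ g i := by
  ext x
  simp [LinearMap.sum_apply]

/-- Surjections between finite-dimensional spaces are eventually bijective, so that endomorphisms
commuting with them eventually have the same trace. -/
theorem eventually_trace_eq_of_surjective {k : Type*} [Field k] (I : ℕ → Type*)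
    [∀ n, AddCommGroup (I n)] [∀ n, Module k (I n)] [∀ n, FiniteDimensional k (I n)]
    (T : ∀ n, I n →ₗ[k] I n) (j : ∀ n, I n →ₗ[k] I (n + 1)) (d : ℕ)
    (hj : ∀ n, d ≤ n → Function.Surjective (j n))
    (hT : ∀ n x, j n (T n x) = T (n + 1) (j n x)) :
    ∃ e : k, ∀ᶠ n in atTop, trace k (I n) (T n) = e := by
  have hle : ∀ n, d ≤ n → Module.finrank k (I (n + 1)) ≤ Module.finrank k (I n) :=
    fun n hn => LinearMap.finrank_le_finrank_of_surjective (hj n hn)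
  obtain ⟨N, hN⟩ : ∃ N, ∀ n, N ≤ n → Module.finrank k (I (d + n)) = Module.finrank k (I (d + N)) := by
    have hanti : Antitone fun n => Module.finrank k (I (d + n)) :=
      antitone_nat_of_succ_le fun n => hle (d + n) (Nat.le_add_right _ _)
    -- A nonincreasing sequence of natural numbers is eventually constant; from then on the
    -- surjections are isomorphisms.
    obtain ⟨N, hN⟩ := WellFoundedGT.monotone_chain_condition
      (⟨fun n => OrderDual.toDual (Module.finrank k (I (d + n))), hanti⟩ : ℕ →o ℕᵒᵈ)
    exact ⟨N, fun n hn => (congrArg OrderDual.ofDual (hN n hn)).symm⟩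
  refine ⟨trace k _ (T (d + N)), eventually_atTop.2 ⟨d + N, fun n hn => ?_⟩⟩
  induction n, hn using Nat.le_induction with
  | base => rfl
  | succ n hn ih =>
    rw [← ih]
    obtain ⟨m, rfl⟩ := Nat.exists_eq_add_of_le (le_trans (Nat.le_add_right d N) hn)
    have hfr : Module.finrank k (I (d + m)) = Module.finrank k (I (d + m + 1)) :=
      (hN m (by omega)).trans (hN (m + 1) (by omega)).symm
    have hinj : Function.Injective (j (d + m)) :=
      (LinearMap.injective_iff_surjective_of_finrank_eq_finrank hfr).2 (hj _ (by omega))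
    let φ := LinearEquiv.ofBijective (j (d + m)) ⟨hinj, hj _ (by omega)⟩
    rw [← trace_conj' (T (d + m)) φ]
    congr 1
    ext x
    obtain ⟨y, rfl⟩ := φ.surjective x
    rw [LinearEquiv.conj_apply_apply, LinearEquiv.symm_apply_apply]
    exact (hT _ y).symm

theorem Representation.averageMap_apply {k G V : Type*} [Field k] [Group G] [Fintype G]
    [Invertible (Fintype.card G : k)] [AddCommGroup V] [Module k V] (ρ : Representation k G V) :
    ρ.averageMap = (Fintype.card G : k)⁻¹ • ∑ g, ρ g := by
  simp [GroupAlgebra.average, map_sum]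

/-- Averaging projects onto the invariants and commutes with `T n`, so the averaged trace is the
trace of `T n` on the invariants. Applying `ι n` and then averaging maps invariants to invariants;
this is surjective once the translates of the image of `ι n` span, because averaging does not see
translations. -/
theorem eventually_average_trace_eq {k : Type*} [Field k] [CharZero k] (U : ℕ → Type*)
    [∀ n, AddCommGroup (U n)] [∀ n, Module k (U n)] [∀ n, FiniteDimensional k (U n)]
    (ρ : ∀ n, Representation k (Equiv.Perm (Fin n)) (U n))
    (T : ∀ n, U n →ₗ[k] U n) (ι : ∀ n, U n →ₗ[k] U (n + 1))
    (hTρ : ∀ n σ, T n ∘ₗ ρ n σ = ρ n σ ∘ₗ T n) (hTι : ∀ n, ι n ∘ₗ T n = T (n + 1) ∘ₗ ι n)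
    (hι : ∀ n σ, ∃ σ', ι n ∘ₗ ρ n σ = ρ (n + 1) σ' ∘ₗ ι n)
    (d : ℕ) (hd : ∀ n, d ≤ n → ⨆ σ, range (ρ (n + 1) σ ∘ₗ ι n) = ⊤) :
    ∃ e : k, ∀ᶠ n in atTop,
      (n.factorial : k)⁻¹ * ∑ σ, trace k (U n) (ρ n σ ∘ₗ T n) = e := by
  have hcard : ∀ n : ℕ, Fintype.card (Equiv.Perm (Fin n)) = n.factorial := fun n => by
    rw [Fintype.card_perm, Fintype.card_fin]
  let _ : ∀ n : ℕ, Invertible (Fintype.card (Equiv.Perm (Fin n)) : k) := fun n =>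
    invertibleOfNonzero (by rw [hcard]; exact_mod_cast n.factorial_ne_zero)
  let p : ∀ n, U n →ₗ[k] U n := fun n => (ρ n).averageMap
  have hp : ∀ n, p n = (n.factorial : k)⁻¹ • ∑ σ, ρ n σ := fun n => by
    rw [← hcard]; exact (ρ n).averageMap_apply
  have hmem : ∀ n x, p n x ∈ (ρ n).invariants := fun n => (ρ n).averageMap_invariant
  have hid : ∀ n x, x ∈ (ρ n).invariants → p n x = x := fun n => (ρ n).averageMap_id
  have hpT : ∀ n, p n ∘ₗ T n = T n ∘ₗ p n := fun n => by
    rw [hp, LinearMap.smul_comp, LinearMap.comp_smul, sum_linearMap_comp, linearMap_comp_sum]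
    simp only [hTρ]
  have hpρ : ∀ n σ, p n ∘ₗ ρ n σ = p n := fun n σ => by
    rw [hp, LinearMap.smul_comp, sum_linearMap_comp]
    congr 1
    refine Fintype.sum_equiv (Equiv.mulRight σ) _ _ fun g => ?_
    rw [Equiv.coe_mulRight, map_mul]
    rfl
  -- Any preimage under p ∘ ι may thus be averaged first, which makes it invariant.
  have hpιp : ∀ n, p (n + 1) ∘ₗ ι n ∘ₗ p n = p (n + 1) ∘ₗ ι n := fun n => by
    have h1 : ∀ σ, p (n + 1) ∘ₗ ι n ∘ₗ ρ n σ = p (n + 1) ∘ₗ ι n := fun σ => by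
      obtain ⟨σ', h⟩ := hι n σ
      rw [h, ← LinearMap.comp_assoc, hpρ]
    rw [hp n, LinearMap.comp_smul, LinearMap.comp_smul, linearMap_comp_sum, linearMap_comp_sum]
    simp only [h1, Finset.sum_const, Finset.card_univ, hcard]
    rw [← Nat.cast_smul_eq_nsmul k, smul_smul, inv_mul_cancel₀, one_smul]
    exact_mod_cast n.factorial_ne_zero
  have hTI : ∀ n, ∀ x ∈ (ρ n).invariants, T n x ∈ (ρ n).invariants := fun n x hx g => by
    have := LinearMap.congr_fun (hTρ n g) x
    simp only [LinearMap.comp_apply] at this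
    rw [← this, hx g]
  let j : ∀ n, (ρ n).invariants →ₗ[k] (ρ (n + 1)).invariants := fun n =>
    ((p (n + 1) ∘ₗ ι n).codRestrict _ fun x => hmem _ _) ∘ₗ (ρ n).invariants.subtype
  have hj : ∀ n, d ≤ n → Function.Surjective (j n) := by
    intro n hn y
    have key : ∀ x, p (n + 1) x ∈ range (p (n + 1) ∘ₗ ι n) := by
      have : (⨆ σ, range (ρ (n + 1) σ ∘ₗ ι n)) ≤
          (range (p (n + 1) ∘ₗ ι n)).comap (p (n + 1)) := by
        refine iSup_le fun σ => ?_
        rintro _ ⟨u, rfl⟩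
        rw [Submodule.mem_comap, ← LinearMap.comp_apply, ← LinearMap.comp_assoc, hpρ]
        exact ⟨u, rfl⟩
      rw [hd n hn] at this
      exact fun x => this trivial
    obtain ⟨u, hu⟩ := key y
    refine ⟨⟨p n u, hmem n u⟩, Subtype.ext ?_⟩
    rw [hid _ _ y.2] at hu
    rw [← hu]
    exact LinearMap.congr_fun (hpιp n) u
  have hTj : ∀ n x, j n ((T n).restrict (hTI n) x) = (T (n + 1)).restrict (hTI (n + 1)) (j n x) := by
    intro n x
    refine Subtype.ext ?_
    have h1 := LinearMap.congr_fun (hTι n) x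
    have h2 := LinearMap.congr_fun (hpT (n + 1)) (ι n x)
    simp only [LinearMap.comp_apply] at h1 h2
    change p (n + 1) (ι n (T n x)) = T (n + 1) (p (n + 1) (ι n x))
    rw [h1, h2]
  obtain ⟨e, he⟩ := eventually_trace_eq_of_surjective (fun n => (ρ n).invariants)
    (fun n => (T n).restrict (hTI n)) j d hj hTj
  refine ⟨e, he.mono fun n hn => ?_⟩
  rw [← hn]
  have h2 : ∀ x, (T n ∘ₗ p n) x ∈ (ρ n).invariants := fun x => hTI n _ (hmem n x)
  have h3 : (T n).restrict (hTI n) = (T n ∘ₗ p n).restrict fun x _ => h2 x := by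
    ext x
    simp [LinearMap.restrict_apply, hid n x x.2]
  rw [h3, LinearMap.trace_restrict_eq_of_forall_mem _ _ h2, ← hpT, hp, LinearMap.smul_comp,
    sum_linearMap_comp, map_smul, map_sum, smul_eq_mul]

end Averaging

/-! ### Spanning sets of finitely generated FI-modules -/

namespace FIModule

/-- The linear map induced by an injection between standard sets. -/
def mapEmb {k : Type u} [Ring k] (V : FIModule.{v} k) {m n : ℕ} (g : Fin m ↪ Fin n) :
    V.obj (FI.std m) →ₗ[k] V.obj (FI.std n) :=
  (V.map (show FI.std m ⟶ FI.std n from g)).hom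

theorem mapEmb_trans {k : Type u} [Ring k] (V : FIModule.{v} k) {l m n : ℕ} (g : Fin l ↪ Fin m)
    (h : Fin m ↪ Fin n) : V.mapEmb (g.trans h) = V.mapEmb h ∘ₗ V.mapEmb g := by
  change (V.map ((show FI.std l ⟶ FI.std m from g) ≫ (show FI.std m ⟶ FI.std n from h))).hom = _
  rw [V.map_comp]
  rfl

theorem rep_apply {k : Type u} [CommRing k] (V : FIModule.{v} k) {n : ℕ}
    (σ : Equiv.Perm (Fin n)) : V.rep n σ = V.mapEmb σ.toEmbedding := rfl

/-- A finitely generated FI-module is spanned in each degree by the images of finitely many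
generators. -/
theorem FinitelyGenerated.exists_span_eq_top {k : Type u} [Ring k] {V : FIModule.{v} k}
    (hV : V.FinitelyGenerated) : ∃ S : Set (Σ n : ℕ, V.obj (FI.std n)), S.Finite ∧
      ∀ n, Submodule.span k (Set.range fun p : Σ s : S, (Fin s.1.1 ↪ Fin n) =>
        V.mapEmb p.2 p.1.1.2) = ⊤ := by
  obtain ⟨S, hS, h⟩ := hV
  refine ⟨S, hS, fun n => ?_⟩
  let W : Sub V :=
    { submodule := fun X => Submodule.span k
        (Set.range fun p : Σ s : S, (FI.std s.1.1 ⟶ X) => (V.map p.2).hom p.1.1.2)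
      map_mem := fun {X Y} f x hx => by
        induction hx using Submodule.span_induction with
        | mem x hx =>
          obtain ⟨⟨s, g⟩, rfl⟩ := hx
          refine Submodule.subset_span ⟨⟨s, g ≫ f⟩, ?_⟩
          simp
        | zero => simp
        | add x y _ _ hx hy => rw [map_add]; exact add_mem hx hy
        | smul a x _ hx => rw [map_smul]; exact Submodule.smul_mem _ _ hx }
  refine h W (fun s hs => Submodule.subset_span ⟨⟨⟨s, hs⟩, 𝟙 _⟩, ?_⟩) (FI.std n)
  simp

theorem FinitelyGenerated.finiteDimensional {k : Type u} [Field k] {V : FIModule.{v} k}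
    (hV : V.FinitelyGenerated) (n : ℕ) : FiniteDimensional k (V.obj (FI.std n)) := by
  obtain ⟨S, hS, h⟩ := hV.exists_span_eq_top
  have := hS.to_subtype
  exact ⟨Submodule.fg_def.2 ⟨_, Set.finite_range _, h n⟩⟩

end FIModule

theorem trace_lmapDomain {k X : Type*} [Field k] [Finite X] (g : X → X) :
    LinearMap.trace k (X →₀ k) (Finsupp.lmapDomain k k g) = Nat.card {x // g x = x} := by
  classical
  have := Fintype.ofFinite X
  rw [LinearMap.trace_eq_matrix_trace k Finsupp.basisSingleOne, Matrix.trace]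
  simp [LinearMap.toMatrix_apply, Finsupp.mapDomain_single, Finsupp.single_apply,
    Fintype.card_subtype]

/-- The number of maps intertwining `τ` and `σ`. -/
noncomputable def intertwinerCount {A X : Type*} (τ : Equiv.Perm A) (σ : Equiv.Perm X) : ℕ :=
  Nat.card {f : A → X // ∀ a, σ (f a) = f (τ a)}

/-- Some permutation moves a point outside a given small set to the last position. -/
theorem exists_perm_forall_ne_last {n : ℕ} (s : Set (Fin (n + 1))) (hs : s ≠ Set.univ) :
    ∃ σ : Equiv.Perm (Fin (n + 1)), ∀ x ∈ s, σ x ≠ Fin.last n := by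
  obtain ⟨z, hz⟩ := (Set.ne_univ_iff_exists_notMem s).1 hs
  refine ⟨Equiv.swap z (Fin.last n), fun x hx h => hz ?_⟩
  rw [← Equiv.eq_symm_apply, Equiv.symm_swap, Equiv.swap_apply_right] at h
  exact h ▸ hx

/-! ### Stable inner products with intertwiner counts -/

namespace FIModule

open TensorProduct Filter

variable {k : Type u} [Field k]

/-- The permutation representation on functions with values in the standard set. -/
noncomputable def funRep (k : Type u) [Field k] (A : Type) (n : ℕ) :
    Representation k (Equiv.Perm (Fin n)) ((A → Fin n) →₀ k) where
  toFun σ := Finsupp.lmapDomain k k (σ ∘ ·)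
  map_one' := by ext; simp
  map_mul' σ τ := by
    ext; simp [Finsupp.mapDomain_single, Function.comp_assoc, Equiv.Perm.coe_mul]

/-- The averaging result is applied to k[Fin n ^ A] ⊗ Vₙ, with precomposition by τ⁻¹ on the first
factor. Composed with σ, this permutes the basis by f ↦ σ ∘ f ∘ τ⁻¹, whose fixed points are the
intertwiners. -/
theorem FinitelyGenerated.eventually_average_eq [CharZero k] {V : FIModule.{v} k}
    (hV : V.FinitelyGenerated) {A : Type} [Finite A] (τ : Equiv.Perm A) :
    ∃ e : k, ∀ᶠ n : ℕ in atTop, (n.factorial : k)⁻¹ *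
      ∑ σ, (V.rep n).character σ * intertwinerCount τ σ = e := by
  have hfd := hV.finiteDimensional
  obtain ⟨S, hS, hspan⟩ := hV.exists_span_eq_top
  obtain ⟨d, hd⟩ : ∃ d, ∀ s ∈ S, s.1 ≤ d := by
    obtain ⟨d, hd⟩ := (hS.image Sigma.fst).bddAbove
    exact ⟨d, fun s hs => hd ⟨s, hs, rfl⟩⟩
  let T : ∀ n, ((A → Fin n) →₀ k) ⊗[k] V.obj (FI.std n) →ₗ[k] _ := fun n =>
    TensorProduct.map (Finsupp.lmapDomain k k (· ∘ τ.symm)) LinearMap.id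
  let ι : ∀ n, ((A → Fin n) →₀ k) ⊗[k] V.obj (FI.std n) →ₗ[k]
      ((A → Fin (n + 1)) →₀ k) ⊗[k] V.obj (FI.std (n + 1)) := fun n =>
    TensorProduct.map (Finsupp.lmapDomain k k (Fin.castSuccEmb ∘ ·)) (V.mapEmb Fin.castSuccEmb)
  have hTρ : ∀ n σ, T n ∘ₗ (funRep k A n).tprod (V.rep n) σ =
      (funRep k A n).tprod (V.rep n) σ ∘ₗ T n := by
    intro n σ
    ext f x
    simp [T, funRep, Finsupp.mapDomain_single, Function.comp_assoc]
  have hTι : ∀ n, ι n ∘ₗ T n = T (n + 1) ∘ₗ ι n := by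
    intro n
    ext f x
    simp [T, ι, Finsupp.mapDomain_single, Function.comp_assoc]
  have hι : ∀ n σ, ∃ σ', ι n ∘ₗ (funRep k A n).tprod (V.rep n) σ =
      (funRep k A (n + 1)).tprod (V.rep (n + 1)) σ' ∘ₗ ι n := by
    intro n σ
    refine ⟨σ.viaFintypeEmbedding Fin.castSuccEmb, ?_⟩
    have h1 : σ.toEmbedding.trans Fin.castSuccEmb = Fin.castSuccEmb.trans
        (σ.viaFintypeEmbedding Fin.castSuccEmb).toEmbedding := by
      ext x : 1
      exact (σ.viaFintypeEmbedding_apply_image Fin.castSuccEmb x).symm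
    have h2 := V.mapEmb_trans σ.toEmbedding Fin.castSuccEmb
    rw [h1, mapEmb_trans] at h2
    have h3 : ∀ f : A → Fin n, Fin.castSuccEmb ∘ σ ∘ f =
        σ.viaFintypeEmbedding Fin.castSuccEmb ∘ Fin.castSuccEmb ∘ f := fun f => by
      funext a
      exact congrArg (fun g : Fin n ↪ Fin (n + 1) => g (f a)) h1
    refine TensorProduct.ext' fun w x => ?_
    change (ι n) ((funRep k A n σ w) ⊗ₜ (V.rep n σ x)) = ((funRep k A (n + 1)).tprod _ _) (_ ⊗ₜ _)
    rw [Representation.tprod_apply, TensorProduct.map_tmul, TensorProduct.map_tmul]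
    congr 1
    · simp only [funRep, MonoidHom.coe_mk, OneHom.coe_mk, Finsupp.lmapDomain_apply,
        ← Finsupp.mapDomain_comp]
      congr 1
      funext f
      exact h3 f
    · exact (LinearMap.congr_fun h2 x).symm
  -- A spanning tensor involves f : A → Fin (n + 1) and an injection from at most d points, hence at
  -- most d + |A| < n + 1 values. A permutation moves these values off the last point, so the tensor
  -- is a translate of one from degree n.
  have hsurj : ∀ n, d + Nat.card A ≤ n →
      ⨆ σ, LinearMap.range ((funRep k A (n + 1)).tprod (V.rep (n + 1)) σ ∘ₗ ι n) = ⊤ := by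
    intro n hn
    refine Submodule.eq_top_iff'.2 fun t => ?_
    induction t using TensorProduct.induction_on with
    | zero => exact zero_mem _
    | add x y hx hy => exact add_mem hx hy
    | tmul w x =>
      induction w using Finsupp.induction_linear with
      | zero => rw [zero_tmul]; exact zero_mem _
      | add x y hx hy => rw [add_tmul]; exact add_mem hx hy
      | single f c =>
        have hx : x ∈ Submodule.span k (Set.range fun p : Σ s : S, (Fin s.1.1 ↪ Fin (n + 1)) =>
            V.mapEmb p.2 p.1.1.2) := by rw [hspan]; trivial
        induction hx using Submodule.span_induction with
        | zero => rw [tmul_zero]; exact zero_mem _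
        | add x y _ _ hx hy => rw [tmul_add]; exact add_mem hx hy
        | smul a x _ hx => rw [tmul_smul]; exact Submodule.smul_mem _ _ hx
        | mem x hx =>
          obtain ⟨⟨⟨⟨m, s⟩, hs⟩, h⟩, rfl⟩ := hx
          obtain ⟨σ, hσ⟩ := exists_perm_forall_ne_last (Set.range f ∪ Set.range h) (by
            intro hu
            have h1 := Set.ncard_union_le (Set.range f) (Set.range h)
            rw [hu, Set.ncard_univ, Nat.card_eq_fintype_card, Fintype.card_fin] at h1
            have h2 : (Set.range f).ncard ≤ Nat.card A := Finite.card_range_le f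
            have h3 : (Set.range h).ncard ≤ Nat.card (Fin m) := Finite.card_range_le h
            rw [Nat.card_fin] at h3
            have := hd _ hs
            simp only at this
            omega)
          have hf : ∀ a, σ (f a) ≠ Fin.last n := fun a => hσ _ (Or.inl ⟨a, rfl⟩)
          have hh : ∀ a, σ (h a) ≠ Fin.last n := fun a => hσ _ (Or.inr ⟨a, rfl⟩)
          let h₀ : Fin m ↪ Fin n := ⟨fun a => (σ (h a)).castPred (hh a), fun a b hab => by
            simpa using hab⟩
          have e1 : (h₀.trans Fin.castSuccEmb).trans (σ⁻¹ : Equiv.Perm _).toEmbedding = h := by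
            ext x : 1
            exact σ.symm_apply_apply (h x)
          refine Submodule.mem_iSup_of_mem σ⁻¹
            ⟨Finsupp.single (fun a => (σ (f a)).castPred (hf a)) c ⊗ₜ V.mapEmb h₀ s, ?_⟩
          have e2 : V.mapEmb (σ⁻¹ : Equiv.Perm _).toEmbedding
              (V.mapEmb Fin.castSuccEmb (V.mapEmb h₀ s)) = V.mapEmb h s := by
            rw [← LinearMap.comp_apply, ← mapEmb_trans, ← LinearMap.comp_apply, ← mapEmb_trans,
              ← Function.Embedding.trans_assoc, e1]
          rw [LinearMap.comp_apply, TensorProduct.map_tmul, Representation.tprod_apply,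
            TensorProduct.map_tmul, rep_apply, e2]
          congr 1
          simp [funRep, Finsupp.mapDomain_single, Function.comp_def]
  obtain ⟨e, he⟩ := eventually_average_trace_eq
    (fun n => ((A → Fin n) →₀ k) ⊗[k] V.obj (FI.std n))
    (fun n => (funRep k A n).tprod (V.rep n)) T ι hTρ hTι hι (d + Nat.card A) hsurj
  refine ⟨e, he.mono fun n hn => ?_⟩
  rw [← hn]
  congr 1
  refine Finset.sum_congr rfl fun σ _ => ?_
  have h1 : (funRep k A n).tprod (V.rep n) σ ∘ₗ T n =
      TensorProduct.map (Finsupp.lmapDomain k k fun f => σ ∘ f ∘ τ.symm) (V.rep n σ) := by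
    ext f x
    simp [T, funRep, Finsupp.mapDomain_single]
  rw [h1, LinearMap.trace_tensorProduct', trace_lmapDomain, mul_comm]
  congr 2
  refine Nat.card_congr (Equiv.subtypeEquivRight fun f => ?_)
  rw [funext_iff, τ.forall_congr_left]
  simp

end FIModule

/-! ### Counting solutions of equations between translates -/

section Elimination

open Equiv

/-- `f` solves the equations `σ ^ i (f a) = σ ^ j (f b)` for all `((a, i), (b, j))` in `R`. -/
def IsSolution {A X : Type*} (R : Set ((A × ℤ) × (A × ℤ))) (σ : Perm X) (f : A → X) : Prop :=
  ∀ p ∈ R, (σ ^ p.1.2) (f p.1.1) = (σ ^ p.2.2) (f p.2.1)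

/-- Product over `j ∈ L` of the number of fixed points of `σ ^ j`. -/
noncomputable def fixProd {X : Type*} (L : List ℕ) (σ : Perm X) : ℕ :=
  (L.map fun j => Nat.card {x // (σ ^ j) x = x}).prod

/-- The exponents i for which σ ^ i fixes x form a subgroup of ℤ. -/
theorem zpow_apply_eq_self_iff_of_closure {X : Type*} (S : Set ℤ) (j : ℤ)
    (hj : AddSubgroup.closure S = AddSubgroup.zmultiples j) (σ : Perm X) (x : X) :
    (∀ i ∈ S, (σ ^ i) x = x) ↔ (σ ^ j.natAbs) x = x := by
  let H : AddSubgroup ℤ :=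
    { carrier := {i | (σ ^ i) x = x}
      zero_mem' := by simp
      add_mem' := fun {a b} ha hb => by
        simp only [Set.mem_ofPred_eq] at *
        rw [zpow_add, Perm.mul_apply, hb, ha]
      neg_mem' := fun {a} ha => by
        simp only [Set.mem_ofPred_eq] at *
        rw [zpow_neg, Perm.inv_eq_iff_eq, ha] }
  have h1 : (∀ i ∈ S, (σ ^ i) x = x) ↔ AddSubgroup.closure S ≤ H :=
    (AddSubgroup.closure_le H).symm
  have h2 : (σ ^ j.natAbs) x = x ↔ j ∈ H := by
    rw [← zpow_natCast]
    change ((j.natAbs : ℕ) : ℤ) ∈ H ↔ _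
    rcases Int.natAbs_eq j with h | h
    · rw [← h]
    · conv_rhs => rw [h, neg_mem_iff]
  rw [h1, h2, hj, AddSubgroup.zmultiples_le]

/-- Substitution of `σ ^ e (f a)` for the value of `f` at the distinguished point. -/
def substNone {A : Type*} (a : A) (e : ℤ) : Option A × ℤ → A × ℤ
  | (none, i) => (a, i + e)
  | (some b, i) => (b, i)

/-- The value at `none` is determined by the value at `a`, so that unknown can be substituted away.
-/
theorem card_isSolution_of_link {A X : Type*} (R : Set ((Option A × ℤ) × (Option A × ℤ))) (a : A)
    (e : ℤ) (σ : Perm X) (h : ∀ f : Option A → X, IsSolution R σ f →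
      f none = (σ ^ e) (f (some a))) :
    Nat.card {f // IsSolution R σ f} =
      Nat.card {f // IsSolution (Prod.map (substNone a e) (substNone a e) '' R) σ f} := by
  let ext : (A → X) → Option A → X := fun f o => o.elim ((σ ^ e) (f a)) f
  have key : ∀ f : A → X, IsSolution (Prod.map (substNone a e) (substNone a e) '' R) σ f ↔
      IsSolution R σ (ext f) := by
    intro f
    have h1 : ∀ q : Option A × ℤ, (σ ^ (substNone a e q).2) (f (substNone a e q).1) =
        (σ ^ q.2) (ext f q.1) := by
      rintro ⟨_ | b, i⟩
      · simp [substNone, ext, zpow_add]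
      · rfl
    simp only [IsSolution, Set.forall_mem_image, Prod.map_fst, Prod.map_snd, h1]
  refine Nat.card_congr
    { toFun := fun f => ⟨fun b => f.1 (some b), (key _).2 ?_⟩
      invFun := fun f => ⟨ext f.1, (key _).1 f.2⟩
      left_inv := fun f => Subtype.ext ?_
      right_inv := fun f => Subtype.ext (funext fun b => rfl) }
  · have : ext (fun b => f.1 (some b)) = f.1 := by
      funext o
      cases o with
      | none => exact (h f.1 f.2).symm
      | some b => rfl
    rw [this]
    exact f.2
  · funext o
    cases o with
    | none => exact (h f.1 f.2).symm
    | some b => rfl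

/-- The number of solutions of a system of equations `σ ^ i (f a) = σ ^ j (f b)` is a product of
numbers of fixed points of powers of `σ`, the exponents depending only on the system. -/
theorem exists_card_isSolution_eq_fixProd (A : Type) [Finite A] :
    ∀ R : Set ((A × ℤ) × (A × ℤ)), ∃ L : List ℕ, ∀ (X : Type) (σ : Perm X),
      Nat.card {f // IsSolution R σ f} = fixProd L σ := by
  induction A using Finite.induction_empty_option with
  | @of_equiv A B e ih =>
    intro R
    obtain ⟨L, hL⟩ := ih {p | (Prod.map (Prod.map e id) (Prod.map e id) p) ∈ R}
    refine ⟨L, fun X σ => ?_⟩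
    rw [← hL]
    refine Nat.card_congr (Equiv.subtypeEquiv (e.arrowCongr (Equiv.refl X)).symm fun f => ?_)
    constructor
    · intro h p hp
      exact h _ hp
    · rintro h ⟨⟨a, i⟩, ⟨b, j⟩⟩ hp
      have := h ((e.symm a, i), (e.symm b, j)) (by simpa using hp)
      simpa using this
  | h_empty =>
    intro R
    refine ⟨[], fun X σ => ?_⟩
    have : Unique {f : PEmpty → X // IsSolution R σ f} :=
      ⟨⟨⟨fun x => x.elim, fun p => p.1.1.elim⟩⟩, fun f => Subtype.ext (funext fun x => x.elim)⟩
    simp [fixProd]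
  | @h_option A _ ih =>
    intro R
    by_cases hlink : ∃ (a : A) (i j : ℤ), ((none, i), (some a, j)) ∈ R ∨ ((some a, j), (none, i)) ∈ R
    · obtain ⟨a, i, j, hR⟩ := hlink
      obtain ⟨L, hL⟩ := ih (Prod.map (substNone a (j - i)) (substNone a (j - i)) '' R)
      refine ⟨L, fun X σ => ?_⟩
      rw [← hL]
      refine card_isSolution_of_link R a (j - i) σ fun f hf => ?_
      have : (σ ^ i) (f none) = (σ ^ j) (f (some a)) := by
        rcases hR with hR | hR
        · exact hf _ hR
        · exact (hf _ hR).symm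
      rw [sub_eq_neg_add, zpow_add, Perm.mul_apply, ← this, ← Perm.mul_apply, ← zpow_add]
      simp
    -- The unknown at `none` now decouples: its equations only say that σ ^ j fixes it, with j a
    -- generator of the group of exponent differences. Here j = 0 when there is no genuine
    -- condition.
    · push Not at hlink
      obtain ⟨j, hj⟩ := Int.subgroup_cyclic
        (AddSubgroup.closure {i | ∃ p ∈ R, p.1.1 = none ∧ p.2.1 = none ∧ i = p.1.2 - p.2.2})
      rw [← AddSubgroup.zmultiples_eq_closure] at hj
      obtain ⟨L, hL⟩ := ih {p | Prod.map (Prod.map some id) (Prod.map some id) p ∈ R}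
      refine ⟨j.natAbs :: L, fun X σ => ?_⟩
      rw [fixProd, List.map_cons, List.prod_cons, ← fixProd, ← hL, ← Nat.card_prod]
      have key : ∀ f : Option A → X, IsSolution R σ f ↔ (σ ^ j.natAbs) (f none) = f none ∧
          IsSolution {p | Prod.map (Prod.map some id) (Prod.map some id) p ∈ R} σ
            fun a => f (some a) := by
        intro f
        rw [← zpow_apply_eq_self_iff_of_closure _ j hj]
        constructor
        · refine fun h => ⟨?_, fun p hp => h _ hp⟩
          rintro _ ⟨⟨⟨a, i⟩, ⟨b, i'⟩⟩, hp, rfl, rfl, rfl⟩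
          have := h _ hp
          simp only at this
          rw [sub_eq_neg_add, zpow_add, Perm.mul_apply, this, ← Perm.mul_apply, ← zpow_add]
          simp
        · rintro ⟨h1, h2⟩ ⟨⟨_ | a, i⟩, ⟨_ | b, i'⟩⟩ hp
          · have := h1 (i - i') ⟨_, hp, rfl, rfl, rfl⟩
            simp only
            nth_rewrite 2 [← this]
            rw [← Perm.mul_apply, ← zpow_add]
            simp
          · exact absurd hp (hlink b i i').1
          · exact absurd hp (hlink a i' i).2
          · exact h2 ((a, i), (b, i')) hp
      exact Nat.card_congr
        { toFun := fun f => (⟨f.1 none, ((key _).1 f.2).1⟩, ⟨fun a => f.1 (some a), ((key _).1 f.2).2⟩)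
          invFun := fun q => ⟨fun o => o.elim q.1.1 q.2.1, (key _).2 ⟨q.1.2, q.2.2⟩⟩
          left_inv := fun f => Subtype.ext (funext fun o => by cases o <;> rfl)
          right_inv := fun q => rfl }

/-- The permutation of a disjoint union of cyclically ordered sets of given sizes rotating each of
them. -/
def sigmaRotate (L : List ℕ) : Perm (Σ i : Fin L.length, Fin (L.get i)) :=
  Equiv.sigmaCongrRight fun i => finRotate (L.get i)

/-- An intertwiner is determined by its value at 0, and closing the cycle requires exactly that σ ^
j fix this value. -/
theorem intertwinerCount_finRotate {X : Type*} (j : ℕ) (hj : j ≠ 0) (σ : Perm X) :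
    intertwinerCount (finRotate j) σ = Nat.card {x // (σ ^ j) x = x} := by
  obtain ⟨j, rfl⟩ := Nat.exists_eq_succ_of_ne_zero hj
  have key : ∀ f : Fin (j + 1) → X, (∀ a, σ (f a) = f (finRotate (j + 1) a)) →
      ∀ a : Fin (j + 1), f a = (σ ^ (a : ℕ)) (f 0) := by
    intro f hf a
    induction a using Fin.induction with
    | zero => simp
    | succ a ih =>
      have := hf a.castSucc
      rw [finRotate_apply, Fin.coeSucc_eq_succ] at this
      rw [← this, ih, Fin.val_succ, Fin.val_castSucc, pow_succ', Perm.mul_apply]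
  refine Nat.card_congr
    { toFun := fun f => ⟨f.1 0, ?_⟩
      invFun := fun x => ⟨fun a => (σ ^ (a : ℕ)) x.1, fun a => ?_⟩
      left_inv := fun f => Subtype.ext (funext fun a => (key f.1 f.2 a).symm)
      right_inv := fun x => by simp }
  · have h := f.2 (Fin.last j)
    rw [key f.1 f.2 (Fin.last j), finRotate_last, Fin.val_last] at h
    change (σ ^ (j + 1)) (f.1 0) = f.1 0
    rw [pow_succ', Perm.mul_apply, h]
  · induction a using Fin.lastCases with
    | last =>
      rw [finRotate_last]
      simp only [Fin.val_last, Fin.val_zero, pow_zero, Perm.one_apply]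
      rw [← Perm.mul_apply, ← pow_succ']
      exact x.2
    | cast a =>
      rw [finRotate_apply, Fin.coeSucc_eq_succ]
      simp only [Fin.val_succ, Fin.val_castSucc, pow_succ', Perm.mul_apply]

theorem intertwinerCount_sigmaRotate {X : Type*} (L : List ℕ) (hL : 0 ∉ L) (σ : Perm X) :
    intertwinerCount (sigmaRotate L) σ = fixProd L σ := by
  have h1 : intertwinerCount (sigmaRotate L) σ =
      Nat.card (∀ i, {f : Fin (L.get i) → X // ∀ a, σ (f a) = f (finRotate _ a)}) :=
    Nat.card_congr
      { toFun := fun f i => ⟨fun a => f.1 ⟨i, a⟩, fun a => f.2 ⟨i, a⟩⟩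
        invFun := fun f => ⟨fun p => (f p.1).1 p.2, fun p => (f p.1).2 p.2⟩
        left_inv := fun f => rfl
        right_inv := fun f => rfl }
  have h2 : (L.map fun j => Nat.card {x // (σ ^ j) x = x}) =
      List.ofFn fun i => Nat.card {x // (σ ^ L.get i) x = x} :=
    List.ext_getElem (by simp) (by simp)
  rw [h1, Nat.card_pi, fixProd, h2, List.prod_ofFn]
  refine Finset.prod_congr rfl fun i _ => ?_
  rw [← intertwinerCount_finRotate _ fun h => hL (h ▸ L.get_mem i)]
  rfl

/-- Zero exponents come from free unknowns and contribute |X|, which does not depend on σ. -/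
theorem fixProd_eq {X : Type*} [Finite X] (L : List ℕ) (σ : Perm X) :
    fixProd L σ = Nat.card X ^ (L.count 0) *
      intertwinerCount (sigmaRotate (L.filter (· ≠ 0))) σ := by
  rw [intertwinerCount_sigmaRotate _ (by simp)]
  induction L with
  | nil => simp [fixProd]
  | cons j L ih =>
    rw [fixProd, List.map_cons, List.prod_cons, ← fixProd, ih]
    by_cases hj : j = 0
    · subst hj
      simp [pow_succ]; ring
    · simp [hj, fixProd]; ring

theorem intertwinerCount_mul {A B X : Type*} (τ : Perm A) (τ' : Perm B) (σ : Perm X) :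
    intertwinerCount τ σ * intertwinerCount τ' σ = intertwinerCount (τ.sumCongr τ') σ := by
  rw [intertwinerCount, intertwinerCount, ← Nat.card_prod]
  exact Nat.card_congr
    { toFun := fun q => ⟨Sum.elim q.1.1 q.2.1, by
        rintro (a | b)
        · exact q.1.2 a
        · exact q.2.2 b⟩
      invFun := fun f => (⟨fun a => f.1 (.inl a), fun a => f.2 (.inl a)⟩,
        ⟨fun b => f.1 (.inr b), fun b => f.2 (.inr b)⟩)
      left_inv := fun q => rfl
      right_inv := fun f => Subtype.ext (funext fun o => by cases o <;> rfl) }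

end Elimination

/-! ### Invariant kernels and coincidence patterns -/

section Patterns

open Equiv

/-- Equal kernels give a bijection between the images, which extends to a permutation since X is
finite. Orbits of tuples are thus classified by coincidence patterns. -/
theorem exists_perm_comp_eq {B X : Type*} [Finite X] (u u' : B → X)
    (h : ∀ a b, u a = u b ↔ u' a = u' b) : ∃ g : Perm X, u' = g ∘ u := by
  classical
  have := Fintype.ofFinite X
  have hker : Setoid.ker u = Setoid.ker u' := Setoid.ext fun a b => h a b
  let e : {x // x ∈ Set.range u} ≃ {x // x ∈ Set.range u'} :=
    (Setoid.quotientKerEquivRange u).symm.trans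
      ((Quotient.congrRight fun a b => h a b).trans (Setoid.quotientKerEquivRange u'))
  have he : ∀ b, (e ⟨u b, b, rfl⟩ : X) = u' b := fun b => by
    have : (Setoid.quotientKerEquivRange u).symm ⟨u b, b, rfl⟩ = Quotient.mk (Setoid.ker u) b := by
      rw [Equiv.symm_apply_eq]
      rfl
    change ((Setoid.quotientKerEquivRange u') _ : X) = _
    rw [this]
    rfl
  refine ⟨e.extendSubtype, funext fun b => ?_⟩
  rw [Function.comp_apply, e.extendSubtype_apply_of_mem _ ⟨b, rfl⟩, he]

/-- The pairs of indices at which a function takes the same value. -/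
noncomputable def kernelPairs {B X : Type*} [Fintype B] (u : B → X) : Finset (B × B) :=
  open Classical in Finset.univ.filter fun p => u p.1 = u p.2

theorem mem_kernelPairs {B X : Type*} [Fintype B] (u : B → X) (p : B × B) :
    p ∈ kernelPairs u ↔ u p.1 = u p.2 := by simp [kernelPairs]

/-- The functions counting indices with pattern exactly `S` are linear combinations of those
counting indices with pattern containing a given set. -/
theorem card_pattern_eq_mem_of_card_pattern_superset_mem {k F G P : Type*} [Ring k] [Fintype F]
    [Fintype P] [DecidableEq P] (K : G → F → Finset P) (Q : Submodule k (G → k))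
    (hQ : ∀ R : Finset P,
      (fun σ => ((Finset.univ.filter fun f => R ⊆ K σ f).card : k)) ∈ Q) (S : Finset P) :
    (fun σ => ((Finset.univ.filter fun f => K σ f = S).card : k)) ∈ Q := by
  induction S using WellFoundedGT.induction with
  | ind S ih =>
    have h1 : (fun σ => ((Finset.univ.filter fun f => K σ f = S).card : k)) =
        (fun σ => ((Finset.univ.filter fun f => S ⊆ K σ f).card : k)) -
          ∑ S' ∈ Finset.univ.filter (S < ·),
            fun σ => ((Finset.univ.filter fun f => K σ f = S').card : k) := by
      funext σ
      rw [Pi.sub_apply, Finset.sum_apply, eq_sub_iff_add_eq]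
      have h0 := Finset.card_eq_sum_card_fiberwise (f := K σ)
        (s := Finset.univ.filter fun f => S ⊆ K σ f) (t := Finset.univ.filter (S ≤ ·))
        fun f hf => by simpa using hf
      have h2 : Finset.univ.filter (S ≤ ·) = insert S (Finset.univ.filter (S < ·)) := by
        ext S'
        simp [le_iff_eq_or_lt, eq_comm]
      have h3 : ∀ S' ∈ Finset.univ.filter (S ≤ ·),
          ((Finset.univ.filter fun f => S ⊆ K σ f).filter fun f => K σ f = S') =
            Finset.univ.filter fun f => K σ f = S' := by
        intro S' hS'
        ext f
        simp only [Finset.mem_filter, Finset.mem_univ, true_and] at hS' ⊢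
        exact ⟨fun h => h.2, fun h => ⟨h ▸ hS', h⟩⟩
      rw [Finset.sum_congr rfl fun S' hS' => congrArg Finset.card (h3 S' hS'), h2,
        Finset.sum_insert (by simp)] at h0
      rw [h0]
      push_cast
      rfl
    rw [h1]
    exact Q.sub_mem (hQ S) (Q.sum_mem fun S' hS' => ih S' (by simpa using hS'))

/-- Invariant sums over pairs `(f, σ ∘ f)` are linear combinations of finitely many functions
counting intertwiners. -/
theorem exists_finite_sum_mem_span (k : Type*) [Field k] (A : Type) [Fintype A] :
    ∃ 𝓛 : Set (List ℕ), 𝓛.Finite ∧ (∀ L ∈ 𝓛, 0 ∉ L) ∧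
      ∀ (X : Type) [Fintype X] [DecidableEq X] [DecidableEq A] (h : (A → X) → (A → X) → k),
        (∀ (g : Perm X) f f', h (g ∘ f) (g ∘ f') = h f f') →
        (fun σ : Perm X => ∑ f, h f (σ ∘ f)) ∈ Submodule.span k
          ((fun L σ => (intertwinerCount (sigmaRotate L) σ : k)) '' 𝓛) := by
  classical
  -- The values of f carry exponent 0 and those of σ ∘ f exponent 1, so coincidences become
  -- equations of the kind solved above.
  let t : A ⊕ A → A × ℤ := Sum.elim (fun a => (a, 0)) fun a => (a, 1)
  choose L hL using fun R : Finset ((A ⊕ A) × (A ⊕ A)) =>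
    exists_card_isSolution_eq_fixProd A (Prod.map t t '' (R : Set _))
  refine ⟨Set.range fun R => (L R).filter (· ≠ 0), Set.finite_range _, ?_, ?_⟩
  · rintro _ ⟨R, rfl⟩
    simp
  intro X _ _ _ h hinv
  set Q := Submodule.span k ((fun L (σ : Perm X) => (intertwinerCount (sigmaRotate L) σ : k)) ''
    Set.range fun R => (L R).filter (· ≠ 0))
  let K : Perm X → (A → X) → Finset ((A ⊕ A) × (A ⊕ A)) := fun σ f =>
    kernelPairs (Sum.elim f (σ ∘ f))
  have hM : ∀ R, (fun σ => ((Finset.univ.filter fun f => R ⊆ K σ f).card : k)) ∈ Q := by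
    intro R
    -- The power of |X| is a scalar for fixed X, so it is absorbed by the span; this keeps the
    -- family independent of X.
    have : (fun σ => ((Finset.univ.filter fun f => R ⊆ K σ f).card : k)) =
        ((Nat.card X : k) ^ ((L R).count 0)) •
          fun σ => (intertwinerCount (sigmaRotate ((L R).filter (· ≠ 0))) σ : k) := by
      funext σ
      rw [Pi.smul_apply, smul_eq_mul, ← Nat.cast_pow, ← Nat.cast_mul, ← fixProd_eq, ← hL,
        ← Fintype.card_subtype, ← Nat.card_eq_fintype_card]
      congr 1
      refine Nat.card_congr (Equiv.subtypeEquivRight fun f => ?_)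
      have ht : ∀ q, (σ ^ (t q).2) (f (t q).1) = Sum.elim f (σ ∘ f) q := by
        rintro (a | a) <;> simp [t]
      simp only [IsSolution, Set.forall_mem_image, Prod.map_fst, Prod.map_snd, ht,
        Finset.subset_iff, Finset.mem_coe, K, mem_kernelPairs]
    rw [this]
    exact Q.smul_mem _ (Submodule.subset_span ⟨_, ⟨R, rfl⟩, rfl⟩)
  have hN := card_pattern_eq_mem_of_card_pattern_superset_mem K Q hM
  have hH : ∃ H : Finset ((A ⊕ A) × (A ⊕ A)) → k, ∀ f f',
      h f f' = H (kernelPairs (Sum.elim f f')) := by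
    refine ⟨fun S => if hS : ∃ q : (A → X) × (A → X), kernelPairs (Sum.elim q.1 q.2) = S then
      h hS.choose.1 hS.choose.2 else 0, fun f f' => ?_⟩
    have hS : ∃ q : (A → X) × (A → X),
      kernelPairs (Sum.elim q.1 q.2) = kernelPairs (Sum.elim f f') := ⟨(f, f'), rfl⟩
    dsimp only
    rw [dif_pos hS]
    obtain ⟨g, hg⟩ := exists_perm_comp_eq (Sum.elim hS.choose.1 hS.choose.2) (Sum.elim f f')
      fun a b => by rw [← mem_kernelPairs _ (a, b), hS.choose_spec, mem_kernelPairs]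
    have h1 : f = g ∘ hS.choose.1 := funext fun a => congrFun hg (.inl a)
    have h2 : f' = g ∘ hS.choose.2 := funext fun a => congrFun hg (.inr a)
    exact (congrArg₂ h h1 h2).trans (hinv _ _ _)
  obtain ⟨H, hH⟩ := hH
  have : (fun σ : Perm X => ∑ f, h f (σ ∘ f)) =
      ∑ S, H S • fun σ => ((Finset.univ.filter fun f => K σ f = S).card : k) := by
    funext σ
    rw [Finset.sum_apply, ← Finset.sum_fiberwise_of_maps_to (g := K σ) fun f _ => Finset.mem_univ _]
    refine Finset.sum_congr rfl fun S _ => ?_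
    rw [Pi.smul_apply, smul_eq_mul, mul_comm, ← nsmul_eq_mul, ← Finset.sum_const]
    refine Finset.sum_congr rfl fun f hf => ?_
    rw [hH]
    exact congrArg H (Finset.mem_filter.1 hf).2
  rw [this]
  exact Q.sum_mem fun S _ => Q.smul_mem _ (hN S)

end Patterns

/-- The character of a representation spanned by a finite family permuted by the group, as a sum of
values of an invariant kernel. -/
theorem exists_invariant_character_eq_sum {k G Y M : Type*} [Field k] [CharZero k] [Group G]
    [Finite G] [Fintype Y] [MulAction G Y] [AddCommGroup M] [Module k M] [FiniteDimensional k M]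
    (ρ : Representation k G M) (v : Y → M) (hv : Submodule.span k (Set.range v) = ⊤)
    (hρ : ∀ g y, ρ g (v y) = v (g • y)) :
    ∃ h : Y → Y → k, (∀ (g : G) y y', h (g • y) (g • y') = h y y') ∧
      ∀ g, ρ.character g = ∑ y, h y (g • y) := by
  classical
  have := Fintype.ofFinite G
  let π : (Y →₀ k) →ₗ[k] M := Finsupp.linearCombination k v
  have hπ : LinearMap.range π = ⊤ := by rw [Finsupp.range_linearCombination, hv]
  obtain ⟨s, hs⟩ := π.exists_rightInverse_of_surjective hπ
  have htr : ∀ g, ρ.character g = ∑ y, s (v (g • y)) y := by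
    intro g
    -- By cyclicity the trace is that of s ∘ ρ g ∘ π on the free module on Y, read off its diagonal.
    have h1 : ρ g = (ρ g ∘ₗ π) ∘ₗ s := by rw [LinearMap.comp_assoc, hs, LinearMap.comp_id]
    rw [Representation.character, h1, LinearMap.trace_comp_comm',
      LinearMap.trace_eq_matrix_trace k Finsupp.basisSingleOne, Matrix.trace]
    refine Finset.sum_congr rfl fun y _ => ?_
    simp [LinearMap.toMatrix_apply, π, hρ]
  -- The section s need not be equivariant; averaging its kernel restores invariance and, as
  -- characters are class functions, keeps the sum.
  refine ⟨fun y y' => (Fintype.card G : k)⁻¹ * ∑ a : G, s (v (a • y')) (a • y), ?_, ?_⟩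
  · intro g y y'
    simp only [smul_smul]
    congr 1
    exact Fintype.sum_equiv (Equiv.mulRight g) _ _ fun a => rfl
  · intro g
    have h2 : ∀ a : G, ρ.character g = ∑ y, s (v (a • g • y)) (a • y) := by
      intro a
      rw [← ρ.char_conj g a, htr]
      symm
      refine Fintype.sum_equiv (MulAction.toPerm a) _ _ fun y => ?_
      simp [smul_smul]
    rw [← Finset.mul_sum, Finset.sum_comm, ← Finset.sum_congr rfl fun a _ => h2 a,
      Finset.sum_const, Finset.card_univ, nsmul_eq_mul, inv_mul_cancel_left₀]
    exact_mod_cast Fintype.card_ne_zero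

namespace FIModule

/-- In every degree the character of a finitely generated FI-module is a linear combination of
functions from a fixed finite family. -/
theorem FinitelyGenerated.exists_finite_character_mem_span {k : Type u} [Field k] [CharZero k]
    {V : FIModule.{v} k} (hV : V.FinitelyGenerated) :
    ∃ 𝓛 : Set (List ℕ), 𝓛.Finite ∧ (∀ L ∈ 𝓛, 0 ∉ L) ∧
      ∀ n, (V.rep n).character ∈ Submodule.span k
        ((fun L σ => (intertwinerCount (sigmaRotate L) σ : k)) '' 𝓛) := by
  classical
  have hfd := hV.finiteDimensional
  obtain ⟨S, hS, hspan⟩ := hV.exists_span_eq_top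
  have := hS.fintype
  choose 𝓛 hfin h0 h𝓛 using fun m : ℕ => exists_finite_sum_mem_span k (Fin m)
  refine ⟨⋃ s : S, 𝓛 s.1.1, Set.finite_iUnion fun s => hfin _, ?_, fun n => ?_⟩
  · intro L hL
    obtain ⟨s, hs⟩ := Set.mem_iUnion.1 hL
    exact h0 _ L hs
  obtain ⟨h, hinv, hχ⟩ := exists_invariant_character_eq_sum (V.rep n)
    (fun p : Σ s : S, (Fin s.1.1 ↪ Fin n) => V.mapEmb p.2 p.1.1.2) (hspan n) (by
      rintro σ ⟨s, f⟩
      rw [rep_apply, ← LinearMap.comp_apply, ← mapEmb_trans]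
      rfl)
  have h1 : (V.rep n).character = ∑ s : S, fun σ : Equiv.Perm (Fin n) =>
      ∑ f : Fin s.1.1 ↪ Fin n, h ⟨s, f⟩ ⟨s, σ • f⟩ := by
    funext σ
    rw [hχ, Finset.sum_apply, Fintype.sum_sigma]
    rfl
  rw [h1]
  refine Submodule.sum_mem _ fun s _ => ?_
  -- Extension by zero from injections to all maps preserves invariance.
  let h' : (Fin s.1.1 → Fin n) → (Fin s.1.1 → Fin n) → k := fun f f' =>
    if hf : Function.Injective f ∧ Function.Injective f' then h ⟨s, f, hf.1⟩ ⟨s, f', hf.2⟩ else 0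
  have h2 := h𝓛 s.1.1 (Fin n) h' (by
    intro g f f'
    simp only [h', EquivLike.comp_injective]
    split_ifs with hf
    · exact hinv g ⟨s, f, hf.1⟩ ⟨s, f', hf.2⟩
    · rfl)
  have h3 : (fun σ : Equiv.Perm (Fin n) => ∑ f : Fin s.1.1 ↪ Fin n, h ⟨s, f⟩ ⟨s, σ • f⟩) =
      fun σ : Equiv.Perm (Fin n) => ∑ f, h' f (σ ∘ f) := by
    funext σ
    refine Fintype.sum_of_injective (fun f : Fin s.1.1 ↪ Fin n => (f : Fin s.1.1 → Fin n))
      DFunLike.coe_injective _ _ (fun f hf => dif_neg fun hi => hf ⟨⟨f, hi.1⟩, rfl⟩) fun f => ?_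
    have hf : Function.Injective f ∧ Function.Injective (σ ∘ f) :=
      ⟨f.injective, σ.injective.comp f.injective⟩
    simp only [h']
    rw [dif_pos hf]
    rfl
  rw [h3]
  exact Submodule.span_mono (Set.image_mono (Set.subset_iUnion (fun s : S => 𝓛 s.1.1) s)) h2

end FIModule

/-! ### Fixed points of powers as polynomials in cycle counts -/

section CycleCount

open Equiv Equiv.Perm

theorem Equiv.Perm.pow_apply_eq_self_iff_dvd_card_support_cycleOf {α : Type*} [Fintype α]
    [DecidableEq α] (σ : Perm α) {x : α} (hx : σ x ≠ x) (j : ℕ) :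
    (σ ^ j) x = x ↔ (σ.cycleOf x).support.card ∣ j := by
  have h := σ.zpow_eq_zpow_on_iff (m := j) (n := 0) hx
  rw [zpow_natCast, zpow_zero, Perm.one_apply] at h
  rw [h, Int.zero_emod, ← Int.natCast_mod, Nat.dvd_iff_mod_eq_zero]
  norm_cast

/-- The points are grouped by the cycle containing them, i points to each. -/
theorem Equiv.Perm.card_filter_card_support_cycleOf {α : Type*} [Fintype α] [DecidableEq α]
    (σ : Perm α) (i : ℕ) :
    ((σ.support.filter fun x => (σ.cycleOf x).support.card = i).card) =
      i * σ.cycleType.count i := by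
  have h1 : σ.cycleType.count i = (σ.cycleFactorsFinset.filter fun c => c.support.card = i).card := by
    rw [cycleType_def, Multiset.count_map, Finset.card_def, Finset.filter_val]
    congr 1
    exact Multiset.filter_congr fun c _ => eq_comm
  rw [h1, Finset.card_eq_sum_card_fiberwise (f := σ.cycleOf)
    (t := σ.cycleFactorsFinset.filter fun c => c.support.card = i)]
  · rw [Finset.sum_congr rfl (g := fun _ => i), Finset.sum_const, smul_eq_mul, mul_comm]
    intro c hc
    rw [Finset.mem_filter] at hc
    rw [← hc.2]
    congr 1
    ext x
    simp only [Finset.mem_filter]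
    constructor
    · rintro ⟨⟨hx, -⟩, rfl⟩
      exact mem_support_cycleOf_iff.2 ⟨SameCycle.refl _ _, hx⟩
    · intro hx
      have hcx : c = σ.cycleOf x := cycle_is_cycleOf hx hc.1
      have := mem_cycleFactorsFinset_support_le hc.1 hx
      exact ⟨⟨this, by rw [← hcx]⟩, hcx.symm⟩
  · intro x hx
    simp only [Finset.coe_filter, Set.mem_ofPred_eq] at hx ⊢
    exact ⟨cycleOf_mem_cycleFactorsFinset_iff.2 hx.1, hx.2⟩

/-- The number of fixed points of a power, in terms of the numbers of cycles. -/
theorem card_pow_fixed_eq_sum {n : ℕ} (σ : Perm (Fin n)) (j : ℕ) (hj : j ≠ 0) :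
    Nat.card {x // (σ ^ j) x = x} = ∑ i ∈ j.divisors, i * cycleCount i σ := by
  have h1 : Nat.card {x // (σ ^ j) x = x} =
      (σ.support.filter fun x => (σ.cycleOf x).support.card ∈ j.divisors).card +
        (Fintype.card (Fin n) - σ.support.card) := by
    rw [← Finset.card_compl, Nat.card_eq_fintype_card, Fintype.card_subtype,
      ← Finset.card_union_of_disjoint]
    · congr 1
      ext x
      by_cases hx : σ x = x
      · simp [hx, pow_apply_eq_self_of_apply_eq_self hx]
      · simp [hx, pow_apply_eq_self_iff_dvd_card_support_cycleOf, hj]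
    · exact Finset.disjoint_of_subset_left (Finset.filter_subset _ _) disjoint_compl_right
  -- `cycleType` omits fixed points, so they are added back at i = 1.
  have h2 : ∀ i, i * cycleCount i σ = i * σ.cycleType.count i +
      if i = 1 then Fintype.card (Fin n) - σ.support.card else 0 := by
    intro i
    rw [cycleCount, parts_partition, Multiset.count_add, Multiset.count_replicate, mul_add]
    congr 1
    by_cases hi : i = 1
    · subst hi; simp
    · simp [hi, Ne.symm hi]
  rw [h1, Finset.sum_congr rfl fun i _ => h2 i, Finset.sum_add_distrib, Finset.sum_ite_eq',
    if_pos (Nat.one_mem_divisors.2 hj)]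
  congr 1
  have h3 := Finset.card_eq_sum_card_fiberwise (f := fun x => (σ.cycleOf x).support.card)
    (s := σ.support.filter fun x => (σ.cycleOf x).support.card ∈ j.divisors)
    (t := j.divisors) fun x hx => (Finset.mem_filter.1 hx).2
  rw [h3]
  refine Finset.sum_congr rfl fun i hi => ?_
  rw [← card_filter_card_support_cycleOf, Finset.filter_filter]
  congr 1
  refine Finset.filter_congr fun x _ => ⟨fun h => h.2, fun h => ⟨h ▸ hi, h⟩⟩

theorem cycleCount_one {n : ℕ} (i : ℕ) :
    cycleCount i (1 : Perm (Fin n)) = if i = 1 then n else 0 := by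
  simp [cycleCount, parts_partition, Multiset.count_replicate, eq_comm]

/-- Evaluation of character polynomials, as a ring homomorphism to class functions. -/
noncomputable def charPolyHom (r : ℕ) :
    MvPolynomial (Fin r) ℚ →ₐ[ℚ] (∀ n, Perm (Fin n) → ℚ) :=
  MvPolynomial.aeval fun j _ σ => (cycleCount (j.val + 1) σ : ℚ)

theorem charPolyHom_apply {r : ℕ} (P : MvPolynomial (Fin r) ℚ) {n : ℕ} (σ : Perm (Fin n)) :
    charPolyHom r P n σ = charPolyEval P σ := by
  let ev : (∀ n, Perm (Fin n) → ℚ) →ₐ[ℚ] ℚ :=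
    (Pi.evalAlgHom ℚ (fun _ : Perm (Fin n) => ℚ) σ).comp
      (Pi.evalAlgHom ℚ (fun n => Perm (Fin n) → ℚ) n)
  change ev.comp (charPolyHom r) P = MvPolynomial.eval _ P
  rw [← MvPolynomial.coe_aeval_eq_eval]
  refine DFunLike.congr_fun (?_ : _ = MvPolynomial.aeval _) P
  ext j
  simp [ev, charPolyHom]

theorem fixProd_mem_range_charPolyHom {r : ℕ} (L : List ℕ) (h0 : 0 ∉ L) (hr : ∀ j ∈ L, j ≤ r) :
    (fun n (σ : Perm (Fin n)) => (fixProd L σ : ℚ)) ∈ (charPolyHom r).range := by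
  induction L with
  | nil =>
    have : (fun n (σ : Perm (Fin n)) => (fixProd [] σ : ℚ)) = 1 := by
      funext n σ
      simp [fixProd]
    exact this ▸ (charPolyHom r).range.one_mem
  | cons j L ih =>
    have hj : j ≠ 0 := fun h => h0 (by simp [h])
    have h1 : (fun n (σ : Perm (Fin n)) => (fixProd (j :: L) σ : ℚ)) =
        (∑ i ∈ j.divisors, (i : ℚ) • fun n (σ : Perm (Fin n)) => (cycleCount i σ : ℚ)) *
          fun n σ => (fixProd L σ : ℚ) := by
      funext n σ
      rw [fixProd, List.map_cons, List.prod_cons, ← fixProd, card_pow_fixed_eq_sum _ _ hj]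
      simp [Finset.sum_apply]
    rw [h1]
    refine mul_mem (sum_mem fun i hi => Subalgebra.smul_mem _ ?_ _)
      (ih (fun h => h0 (List.mem_cons_of_mem _ h)) fun i hi => hr i (List.mem_cons_of_mem _ hi))
    have hi0 : 0 < i := Nat.pos_of_mem_divisors hi
    have hir : i ≤ r := (Nat.divisor_le hi).trans (hr j (by simp))
    refine ⟨MvPolynomial.X ⟨i - 1, by omega⟩, ?_⟩
    change charPolyHom r _ = _
    rw [charPolyHom, MvPolynomial.aeval_X]
    simp only [Nat.sub_add_cancel hi0]

/-- The value of a character polynomial at the identity is a polynomial in the degree. -/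
theorem exists_polynomial_charPolyEval_one {r : ℕ} (P : MvPolynomial (Fin r) ℚ) :
    ∃ Q : Polynomial ℚ, ∀ n : ℕ, charPolyEval P (1 : Perm (Fin n)) = Q.eval (n : ℚ) := by
  -- At the identity X₁ = n and every other Xᵢ vanishes.
  refine ⟨MvPolynomial.aeval (fun j : Fin r => if j.val = 0 then Polynomial.X else 0) P,
    fun n => ?_⟩
  rw [charPolyEval, ← Polynomial.coe_evalRingHom, ← MvPolynomial.coe_aeval_eq_eval,
    ← Polynomial.coe_aeval_eq_evalRingHom]
  change _ = ((Polynomial.aeval (n : ℚ)).comp (MvPolynomial.aeval _)) P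
  refine DFunLike.congr_fun (?_ : MvPolynomial.aeval _ = _) P
  ext j
  simp only [cycleCount_one, MvPolynomial.aeval_X, AlgHom.comp_apply]
  split_ifs <;> simp_all

end CycleCount

/-! ### Rationality of characters of symmetric groups -/

section Rationality

open Equiv Equiv.Perm

theorem Equiv.Perm.IsCycle.cycleType_pow_of_coprime {α : Type*} [Fintype α] [DecidableEq α]
    {σ : Perm α} (hσ : σ.IsCycle) {i : ℕ} (hi : i.Coprime (orderOf σ)) :
    (σ ^ i).cycleType = σ.cycleType := by
  have h1 : (σ ^ i).IsCycle := hσ.pow_iff.2 hi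
  rw [hσ.cycleType, h1.cycleType, support_pow_coprime hi]

theorem Equiv.Perm.cycleType_pow_of_coprime {α : Type*} [Fintype α] [DecidableEq α]
    (σ : Perm α) {i : ℕ} (hi : i.Coprime (orderOf σ)) : (σ ^ i).cycleType = σ.cycleType := by
  induction σ using cycle_induction_on with
  | base_one => simp
  | base_cycles σ hσ => exact hσ.cycleType_pow_of_coprime hi
  | induction_disjoint σ τ hd hσ h1 h2 =>
    rw [hd.orderOf] at hi
    rw [hd.commute.mul_pow, (hd.pow_disjoint_pow i i).cycleType_mul, hd.cycleType_mul,
      h1 (hi.coprime_dvd_right (Nat.dvd_lcm_left _ _)),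
      h2 (hi.coprime_dvd_right (Nat.dvd_lcm_right _ _))]

theorem exists_sum_character_pow_eq_natCast {k G M : Type*} [Field k] [CharZero k] [Group G]
    [Finite G] [AddCommGroup M] [Module k M] [FiniteDimensional k M] (ρ : Representation k G M)
    (g : G) : ∃ m : ℕ, ∑ i ∈ Finset.range (orderOf g), ρ.character (g ^ i) = m := by
  classical
  have := Fintype.ofFinite (Subgroup.zpowers g)
  let ρ' : Representation k (Subgroup.zpowers g) M := ρ.comp (Subgroup.zpowers g).subtype
  have hc : (Nat.card (Subgroup.zpowers g) : k) ≠ 0 := Nat.cast_ne_zero.2 Nat.card_pos.ne'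
  let _ := invertibleOfNonzero hc
  have h := ρ'.card_inv_mul_sum_char_eq_finrank
  rw [inv_mul_eq_iff_eq_mul₀ hc] at h
  refine ⟨Nat.card (Subgroup.zpowers g) * Module.finrank k ρ'.invariants, ?_⟩
  rw [Nat.cast_mul, ← h, ← Fin.sum_univ_eq_sum_range (fun i => ρ.character (g ^ i))]
  exact Fintype.sum_equiv (finEquivZPowers (isOfFinOrder_of_finite g)) _ _ fun i => rfl

/-- Characters of symmetric groups in characteristic zero have rational values. -/
theorem exists_rat_character_perm {k M α : Type*} [Field k] [CharZero k] [Fintype α]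
    [DecidableEq α] [AddCommGroup M] [Module k M] [FiniteDimensional k M]
    (ρ : Representation k (Perm α) M) (σ : Perm α) : ∃ q : ℚ, ρ.character σ = q := by
  suffices ρ.character σ ∈ (algebraMap ℚ k).fieldRange by
    obtain ⟨q, hq⟩ := this
    exact ⟨q, by rw [← hq, eq_ratCast]⟩
  induction h : orderOf σ using Nat.strong_induction_on generalizing σ with
  | _ o ih =>
    -- Powers prime to the order are conjugate to σ and contribute φ(o) times its character; the
    -- other powers have smaller order. One solves for the character of σ.
    obtain ⟨m, hm⟩ := exists_sum_character_pow_eq_natCast ρ σ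
    rw [h, ← Finset.sum_filter_add_sum_filter_not _ (fun i => i.Coprime o)] at hm
    have ho : 0 < o := h ▸ orderOf_pos σ
    have h1 : ∑ i ∈ (Finset.range o).filter (fun i => i.Coprime o), ρ.character (σ ^ i) =
        (Nat.totient o : k) * ρ.character σ := by
      rw [Finset.sum_congr rfl (g := fun _ => ρ.character σ), Finset.sum_const, nsmul_eq_mul,
        Nat.totient_eq_card_coprime]
      · simp only [Nat.coprime_comm]
      · intro i hi
        rw [Finset.mem_filter] at hi
        have := isConj_of_cycleType_eq (σ.cycleType_pow_of_coprime (h ▸ hi.2))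
        obtain ⟨c, hc⟩ := isConj_iff.1 this
        exact (ρ.char_conj _ c).symm.trans (congrArg ρ.character hc)
    have h2 : ∑ i ∈ (Finset.range o).filter (fun i => ¬ i.Coprime o), ρ.character (σ ^ i) ∈
        (algebraMap ℚ k).fieldRange := by
      refine sum_mem fun i hi => ih _ ?_ _ rfl
      rw [Finset.mem_filter] at hi
      rw [orderOf_pow, h]
      exact Nat.div_lt_self ho (lt_of_le_of_ne (Nat.gcd_pos_of_pos_left _ ho)
        fun h => hi.2 (by rw [Nat.Coprime, Nat.gcd_comm, ← h]))
    have h3 : (Nat.totient o : k) ≠ 0 := Nat.cast_ne_zero.2 (Nat.totient_pos.2 ho).ne'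
    rw [h1] at hm
    rw [← eq_sub_iff_add_eq, mul_comm, ← eq_div_iff h3] at hm
    rw [hm]
    exact div_mem (sub_mem (natCast_mem _ m) h2) (natCast_mem _ _)

end Rationality

/-! ### Stable Gram matrices and descent to ℚ -/

section GramMatrix

open Filter

/-- A sequence of functions lying in the spans of given functions, with eventually constant inner
products with these functions, is eventually a fixed linear combination of them, provided that their
Gram matrix is eventually constant. -/
theorem exists_eventually_eq_sum {I : Type*} [Fintype I] (G : ℕ → Type*) [∀ n, Fintype (G n)]
    (w : ℕ → ℚ) (hw : ∀ n, w n ≠ 0) (E : I → ∀ n, G n → ℚ) (χ : ∀ n, G n → ℚ)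
    (hχ : ∀ n, χ n ∈ Submodule.span ℚ (Set.range fun i => E i n))
    (h1 : ∀ i, ∃ e, ∀ᶠ n in atTop, w n * ∑ σ, χ n σ * E i n σ = e)
    (h2 : ∀ i j, ∃ e, ∀ᶠ n in atTop, w n * ∑ σ, E i n σ * E j n σ = e) :
    ∃ c : I → ℚ, ∀ᶠ n in atTop, ∀ σ, χ n σ = ∑ i, c i * E i n σ := by
  choose e he using h1
  choose γ hγ using h2
  obtain ⟨N, hN⟩ := eventually_atTop.1
    ((eventually_all.2 he).and (eventually_all.2 fun i => eventually_all.2 (hγ i)))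
  obtain ⟨c, hc⟩ := (Submodule.mem_span_range_iff_exists_fun ℚ).1 (hχ N)
  refine ⟨c, eventually_atTop.2 ⟨N, fun n hn => ?_⟩⟩
  have hinner : ∀ n, N ≤ n → ∀ i,
      w n * ∑ σ, (χ n - ∑ j, c j • E j n) σ * E i n σ = e i - ∑ j, c j * γ j i := by
    intro n hn i
    have hγ' : ∑ j, c j * γ j i = w n * ∑ σ, ∑ j, c j * (E j n σ * E i n σ) := by
      rw [Finset.sum_comm, Finset.mul_sum]
      refine Finset.sum_congr rfl fun j _ => ?_
      rw [← (hN n hn).2 j i, ← Finset.mul_sum, mul_left_comm]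
    rw [hγ', ← (hN n hn).1 i, ← mul_sub, ← Finset.sum_sub_distrib]
    congr 1
    refine Finset.sum_congr rfl fun σ _ => ?_
    simp only [Pi.sub_apply, Finset.sum_apply, Pi.smul_apply, smul_eq_mul, sub_mul,
      Finset.sum_mul, mul_assoc]
  have hzero : ∀ i, e i - ∑ j, c j * γ j i = 0 := fun i => by
    rw [← hinner N le_rfl i, hc]
    simp
  -- This lies in the span and is orthogonal to it, so its sum of rational squares is zero.
  set g := χ n - ∑ j, c j • E j n
  have horth : ∀ i, ∑ σ, g σ * E i n σ = 0 := fun i =>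
    (mul_eq_zero.1 ((hinner n hn i).trans (hzero i))).resolve_left (hw n)
  have hmem : g ∈ Submodule.span ℚ (Set.range fun i => E i n) :=
    sub_mem (hχ n) (sum_mem fun j _ => Submodule.smul_mem _ _ (Submodule.subset_span ⟨j, rfl⟩))
  obtain ⟨b, hb⟩ := (Submodule.mem_span_range_iff_exists_fun ℚ).1 hmem
  have hgg : ∑ σ, g σ * g σ = 0 := by
    have : ∀ σ, g σ * g σ = ∑ i, b i * (g σ * E i n σ) := fun σ => by
      have h3 : g σ = ∑ i, b i * E i n σ := by
        rw [← hb, Finset.sum_apply]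
        rfl
      nth_rewrite 2 [h3]
      rw [Finset.mul_sum]
      exact Finset.sum_congr rfl fun i _ => by ring
    rw [Finset.sum_congr rfl fun σ _ => this σ, Finset.sum_comm]
    exact Finset.sum_eq_zero fun i _ => by rw [← Finset.mul_sum, horth, mul_zero]
  intro σ
  have h0 := (Finset.sum_eq_zero_iff_of_nonneg fun σ _ => mul_self_nonneg (g σ)).1 hgg σ
    (Finset.mem_univ _)
  have h3 : χ n σ - (∑ j, c j • E j n) σ = 0 := mul_self_eq_zero.1 h0
  rw [sub_eq_zero.1 h3, Finset.sum_apply]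
  rfl

/-- A rational function in the span over an extension field of rational functions is in their
rational span. -/
theorem mem_span_rat_of_cast_mem_span {k G I : Type*} [Field k] [CharZero k] (E : I → G → ℚ)
    (χ : G → ℚ)
    (h : (fun σ => (χ σ : k)) ∈ Submodule.span k (Set.range fun i σ => (E i σ : k))) :
    χ ∈ Submodule.span ℚ (Set.range E) := by
  -- A ℚ-linear retraction k → ℚ turns coefficients in k into rational ones.
  obtain ⟨φ, hφ⟩ := (Algebra.linearMap ℚ k).exists_leftInverse_of_injective
    (LinearMap.ker_eq_bot.2 (algebraMap ℚ k).injective)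
  have h1 : ∀ (q : ℚ) (a : k), φ (a * q) = q * φ a := fun q a => by
    rw [mul_comm, ← smul_eq_mul (q : k), Rat.cast_smul_eq_qsmul, map_smul, smul_eq_mul]
  have key : ∀ F ∈ Submodule.span k (Set.range fun i σ => (E i σ : k)), ∀ a : k,
      (fun σ => φ (a * F σ)) ∈ Submodule.span ℚ (Set.range E) := by
    intro F hF
    induction hF using Submodule.span_induction with
    | mem F hF =>
      obtain ⟨i, rfl⟩ := hF
      intro a
      have : (fun σ => φ (a * (E i σ : k))) = φ a • E i := by
        funext σ
        rw [h1, Pi.smul_apply, smul_eq_mul, mul_comm]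
      rw [this]
      exact Submodule.smul_mem _ _ (Submodule.subset_span ⟨i, rfl⟩)
    | zero => intro a; simp only [Pi.zero_apply, mul_zero, map_zero]; exact zero_mem _
    | add F F' _ _ hF hF' =>
      intro a
      simp only [Pi.add_apply, mul_add, map_add]
      exact add_mem (hF a) (hF' a)
    | smul b F _ hF =>
      intro a
      simp only [Pi.smul_apply, smul_eq_mul, ← mul_assoc]
      exact hF _
  have h2 := key _ h 1
  have hone : φ 1 = 1 := by simpa using LinearMap.congr_fun hφ 1
  simpa only [h1, hone, mul_one] using h2

end GramMatrix

/-! ### Assembly of the character polynomial -/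

namespace FIModule

open Filter Equiv

theorem finitelyGenerated_const (k : Type u) [Ring k] :
    FinitelyGenerated ((Functor.const FI).obj (ModuleCat.of k k) : FIModule.{u} k) := by
  refine ⟨{⟨0, (1 : k)⟩}, Set.finite_singleton _, fun W hW X => ?_⟩
  have h0 : (1 : k) ∈ W.submodule (FI.std 0) := hW _ rfl
  have h1 : (1 : k) ∈ W.submodule X :=
    W.map_mem (show FI.std 0 ⟶ X from ⟨fun i => i.elim0, fun i => i.elim0⟩) _ h0
  refine Submodule.eq_top_iff'.2 fun (x : k) => ?_
  have h2 : x • (1 : k) ∈ W.submodule X := Submodule.smul_mem _ x h1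
  rwa [smul_eq_mul, mul_one] at h2

/-- A product of counts is the count for the disjoint union, and the constant FI-module has
character 1. -/
theorem eventually_average_intertwinerCount_mul {A B : Type} [Finite A] [Finite B] (τ : Perm A)
    (τ' : Perm B) : ∃ e : ℚ, ∀ᶠ n : ℕ in atTop, (n.factorial : ℚ)⁻¹ *
      ∑ σ : Perm (Fin n), (intertwinerCount τ σ : ℚ) * intertwinerCount τ' σ = e := by
  obtain ⟨e, he⟩ := (finitelyGenerated_const ℚ).eventually_average_eq (τ.sumCongr τ')
  refine ⟨e, he.mono fun n hn => ?_⟩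
  rw [← hn]
  congr 1
  refine Finset.sum_congr rfl fun σ _ => ?_
  have : Representation.character (rep ((Functor.const FI).obj (ModuleCat.of ℚ ℚ)) n) σ = 1 := by
    change LinearMap.trace ℚ ℚ LinearMap.id = 1
    simp
  rw [this, one_mul, ← intertwinerCount_mul, Nat.cast_mul]

/-- The character of a finitely generated FI-module is eventually a fixed rational combination of
products of numbers of fixed points of powers. -/
theorem FinitelyGenerated.exists_eventually_character_eq_sum {k : Type u} [Field k] [CharZero k]
    {V : FIModule.{v} k} (hV : V.FinitelyGenerated) :
    ∃ (s : Finset (List ℕ)) (c : List ℕ → ℚ), (∀ L ∈ s, 0 ∉ L) ∧ ∀ᶠ n : ℕ in atTop,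
      ∀ σ, (V.rep n).character σ = ((∑ L ∈ s, c L * fixProd L σ : ℚ) : k) := by
  classical
  have hfd := hV.finiteDimensional
  obtain ⟨𝓛, hfin, h0, hspan⟩ := hV.exists_finite_character_mem_span
  choose χ hχ using fun n => exists_rat_character_perm (V.rep n)
  have := hfin.fintype
  have h1 : ∀ n, χ n ∈ Submodule.span ℚ
      (Set.range fun (L : 𝓛) σ => (intertwinerCount (sigmaRotate L.1) σ : ℚ)) := by
    intro n
    refine mem_span_rat_of_cast_mem_span (k := k) _ _ ?_
    have h3 := hspan n
    rw [Set.image_eq_range, show (V.rep n).character = fun σ => (χ n σ : k) from funext (hχ n)] at h3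
    simpa only [Rat.cast_natCast] using h3
  have h2 : ∀ L : 𝓛, ∃ e, ∀ᶠ n in atTop, (n.factorial : ℚ)⁻¹ *
      ∑ σ, χ n σ * (intertwinerCount (sigmaRotate L.1) σ : ℚ) = e := by
    intro L
    obtain ⟨e, he⟩ := hV.eventually_average_eq (sigmaRotate L.1)
    obtain ⟨N, hN⟩ := eventually_atTop.1 he
    -- The stable value is only known in k; its expression in degree N shows that it is rational.
    refine ⟨(N.factorial : ℚ)⁻¹ * ∑ σ, χ N σ * (intertwinerCount (sigmaRotate L.1) σ : ℚ),
      eventually_atTop.2 ⟨N, fun n hn => ?_⟩⟩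
    have h3 := (hN n hn).trans (hN N le_rfl).symm
    simp only [hχ] at h3
    refine Rat.cast_injective (α := k) ?_
    push_cast
    exact h3
  obtain ⟨c, hc⟩ := exists_eventually_eq_sum (fun n => Perm (Fin n))
    (fun n => (n.factorial : ℚ)⁻¹) (fun n => inv_ne_zero (Nat.cast_ne_zero.2 n.factorial_ne_zero))
    (fun (L : 𝓛) n σ => (intertwinerCount (sigmaRotate L.1) σ : ℚ)) χ h1 h2
    fun L L' => eventually_average_intertwinerCount_mul _ _
  refine ⟨hfin.toFinset, fun L => if hL : L ∈ 𝓛 then c ⟨L, hL⟩ else 0, by simpa using h0,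
    hc.mono fun n hn σ => ?_⟩
  rw [hχ, hn, Finset.sum_subtype (p := (· ∈ 𝓛)) _ (by simp)]
  congr 1
  refine Finset.sum_congr rfl fun L _ => ?_
  dsimp only
  rw [dif_pos L.2, intertwinerCount_sigmaRotate _ (h0 _ L.2)]

end FIModule

theorem theorem4p3 {k : Type u} [Field k] [CharZero k] (V : FIModule.{v} k)
    (hV : V.FinitelyGenerated) :
    (∀ n : ℕ, FiniteDimensional k (V.obj (FI.std n))) ∧
    ∃ (N r : ℕ) (P : MvPolynomial (Fin r) ℚ), 0 < r ∧
      (∀ n : ℕ, N ≤ n → ∀ σ : Equiv.Perm (Fin n),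
        (V.rep n).character σ = ((charPolyEval P σ : ℚ) : k)) ∧
      ∃ Q : Polynomial ℚ, ∀ n : ℕ, N ≤ n →
        (Module.finrank k (V.obj (FI.std n)) : ℚ) = Q.eval (n : ℚ) := by
  have hfd := hV.finiteDimensional
  refine ⟨hfd, ?_⟩
  obtain ⟨s, c, h0, hc⟩ := hV.exists_eventually_character_eq_sum
  obtain ⟨N, hN⟩ := Filter.eventually_atTop.1 hc
  -- Each exponent is at most the sum of its list; the added 1 ensures r > 0.
  let r := s.sup List.sum + 1
  have hr : ∀ L ∈ s, ∀ j ∈ L, j ≤ r := fun L hL j hj =>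
    ((List.single_le_sum (fun _ _ => Nat.zero_le _) j hj).trans (Finset.le_sup hL)).trans
      (Nat.le_succ _)
  have hmem : (∑ L ∈ s, c L • fun n (σ : Equiv.Perm (Fin n)) => (fixProd L σ : ℚ)) ∈
      (charPolyHom r).range :=
    sum_mem fun L hL =>
      Subalgebra.smul_mem _ (fixProd_mem_range_charPolyHom L (h0 L hL) (hr L hL)) _
  obtain ⟨P, hP⟩ := hmem
  have hχ : ∀ n : ℕ, N ≤ n → ∀ σ : Equiv.Perm (Fin n),
      (V.rep n).character σ = ((charPolyEval P σ : ℚ) : k) := by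
    intro n hn σ
    have h1 : charPolyHom r P n σ = ∑ L ∈ s, c L * fixProd L σ := by
      change (charPolyHom r).toRingHom P n σ = _
      rw [hP]
      simp only [Finset.sum_apply, Pi.smul_apply, smul_eq_mul]
    rw [hN n hn, ← charPolyHom_apply, h1]
  obtain ⟨Q, hQ⟩ := exists_polynomial_charPolyEval_one P
  refine ⟨N, r, P, Nat.succ_pos _, hχ, Q, fun n hn => ?_⟩
  have h1 := hχ n hn 1
  rw [Representation.char_one, hQ] at h1
  exact_mod_cast h1
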